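/- **Setting.** Let $\Theta$ be a parameter set, $d,T\ge 0$, and $\eta:\Theta\times\mathbb R^{d}\to[0,1]$ a reward function, measurable in $\theta$ and twice continuously differentiable in the action $a$, such that for all $\theta\in\Theta$ and $a,a_1,a_2\in\mathbb R^d$ $$\|\nabla_a\eta(\theta,a)\|_2\le\zeta_g,\qquad \|\nabla_a^2\eta(\theta,a)\|_{\rm sp}\le\zeta_h,\qquad \|\nabla^2_a\eta(\theta,a_1)-\nabla^2_a\eta(\theta,a_2)\|_{\rm sp}\le\zeta_{3rd}\|a_1-a_2\|_2,$$ with $\zeta_h>0$. Let $\theta^\star\in\Theta$ be the unknown ground truth (realizability). An $(\epsilon_g,\epsilon_h)$-approximate local maximum of a twice differentiable $f$ is a point $x$ with $\|\nabla f(x)\|_2\le\epsilon_g$ and $\lambda_{\max}(\nabla^2f(x))\le\epsilon_h$. With $\mathfrak A_{\epsilon_g,\epsilon_h}$ the set of these points for $\eta(\theta^\star,\cdot)$, the local regret of actions $a_1,\dots,a_T$ is $$\mathrm{REG}_{\epsilon_g,\epsilon_h}(T)=\sum_{t=1}^T\Big(\inf_{a\in\mathfrak A_{\epsilon_g,\epsilon_h}}\eta(\theta^\star,a)-\eta(\theta^\star,a_t)\Big).$$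 **Loss and complexity.** For $x=((a,a'),(u,v))$ put $\hat y(\theta,x)=[\eta(\theta,a),\ \eta(\theta,a'),\ \langle\nabla_a\eta(\theta,a'),u\rangle,\ \langle\nabla_a^2\eta(\theta,a')u,v\rangle]$, let the labels be $y\in\mathcal Y=[0,1]^2\times\mathbb R^2$, and define, with $\kappa_1=2\zeta_g$, $\kappa_2=640\sqrt2\,\zeta_h$ and $\hat y=\hat y(\theta,x)$, $$\ell((x,y);\theta)=(\hat y_1-y_1)^2+(\hat y_2-y_2)^2+\min(\kappa_1^2,(\hat y_3-y_3)^2)+\min(\kappa_2^2,(\hat y_4-y_4)^2).$$ Let $q$ be the law of $\xi=(u,v)$ with $u,v\sim\mathcal N(0,I_d)$ independent. The sequential Rademacher complexity of the losses is $$\mathfrak R_T=\sup_{\boldsymbol x,\boldsymbol y}\ \mathbb E_{\xi_1,\dots,\xi_T\sim q}\ \mathbb E_{e}\Big[\sup_{\theta\in\Theta}\sum_{t=1}^Te_t\,\ell\big(((\boldsymbol x_t(e_{1:t-1}),\xi_t),\boldsymbol y_t(e_{1:t-1}));\theta\big)\Big],$$ where $e$ is uniform on $\{\pm1\}^T$ and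 $\boldsymbol x,\boldsymbol y$ range over the trees of depth $T$, that is, the sequences of functions $\boldsymbol x_t:\{\pm1\}^{t-1}\to\mathbb R^d\times\mathbb R^d$ and $\boldsymbol y_t:\{\pm1\}^{t-1}\to\mathcal Y$. **Algorithm (ViOlin).** An online learner $\mathcal R$ maps every history of data points $(x_i,y_i)$ to a probability distribution on $\Theta$. ViOlin is run with an online learner $\mathcal R$ whose expected regret over $T$ rounds is at most $2\mathfrak R_T$ against every adversary: $$\mathbb E_{\xi_t\sim q,\ \theta_t\sim p_t}\Big[\sum_{t=1}^T\ell((x_t,y_t);\theta_t)-\inf_{\theta\in\Theta}\sum_{t=1}^T\ell((x_t,y_t);\theta)\Big]\le2\mathfrak R_T,\qquad p_t=\mathcal R((x_i,y_i)_{i<t}),$$ where $x_t=(\bar x_t,\xi_t)$, the adversary chooses $\bar x_t\in\mathbb R^d\times\mathbb R^d$ from the past (including $p_t$) before $\xi_t$ is drawn, and $y_t\in\mathcal Y$ after that. Start with an arbitrary $a_0\in\mathbb R^d$. In round $t=1,\dots,T$ compute $p_t=\mathcal R((x_i,y_i)_{i<t})$, choose $a_t\in\arg\max_{a\in\mathbb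 R^d}\mathbb E_{\theta\sim p_t}[\eta(\theta,a)]$ (ties broken arbitrarily), draw $\xi_t=(u_t,v_t)\sim q$, and set $x_t=((a_t,a_{t-1}),\xi_t)$, $y_t=\hat y(\theta^\star,x_t)$. **Theorem.** Let $C_1=2+\zeta_g/\zeta_h$. For every $0<\epsilon\le\min(1,\zeta_{3rd}/16)$, the actions of ViOlin satisfy $$\mathbb E\big[\mathrm{REG}_{\epsilon,6\sqrt{\zeta_{3rd}\epsilon}}(T)\big]\le\Big(1+C_1\sqrt{4T\mathfrak R_T}\Big)\max\Big(4\zeta_h\epsilon^{-2},\ \sqrt{\zeta_{3rd}}\,\epsilon^{-3/2}\Big).$$ -/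

import Mathlib

open MeasureTheory ProbabilityTheory

noncomputable section

/-! ### Online learning with stochastic input components -/

namespace OnlineLearning

/-- The (outer) expectation of a real function: the infimum of the expectations of its integrable
majorants. It is the usual expectation of an integrable function, and it keeps its meaning for
bounded functions, such as suprema over a parameter set, whose measurability is not guaranteed. -/
def outerExpectation {Ω : Type*} [MeasurableSpace Ω] (μ : Measure Ω) (f : Ω → ℝ) : ℝ :=
  sInf {r : ℝ | ∃ g : Ω → ℝ, Integrable g μ ∧ (∀ ω, f ω ≤ g ω) ∧ r = ∫ ω, g ω ∂μ}

theorem outerExpectation_eq_integral {Ω : Type*} [MeasurableSpace Ω] (μ : Measure Ω)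
    (f : Ω → ℝ) (hf : Integrable f μ) : outerExpectation μ f = ∫ ω, f ω ∂μ := by
  refine IsLeast.csInf_eq ⟨⟨f, hf, fun _ => le_rfl, rfl⟩, ?_⟩
  rintro r ⟨g, hg, hfg, rfl⟩
  exact integral_mono hf hg hfg

/-- A `Z`-valued tree of depth `T`: its node at level `t` (counted from `0`) is a function of the
first `t` signs (`true` is the sign `+1`, `false` is `-1`). -/
abbrev Tree (Z : Type*) (T : ℕ) : Type _ := (t : Fin T) → (Fin t → Bool) → Z

/-- The node of level `t` on the path given by the signs `e`. -/
def Tree.node {Z : Type*} {T : ℕ} (z : Tree Z T) (e : Fin T → Bool) (t : Fin T) : Z :=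
  z t fun j => e (Fin.castLE t.isLt.le j)

/-- The real value of a sign. -/
def signValue (b : Bool) : ℝ := if b then 1 else -1

/-- The sequential Rademacher complexity of the loss class `{ℓ (·) θ : θ}` on a pair of trees:
`E_ξ E_e sup_θ ∑ₜ eₜ ℓ ((xₜ(e), ξₜ), yₜ(e)) θ`, where `ξ₁, …, ξ_T` are i.i.d. with law `q` and the
signs `e` are uniform on `{±1}^T`. -/
def seqRademacherOn {P Ξ Y Θ : Type*} [MeasurableSpace Ξ] (ℓ : (P × Ξ) × Y → Θ → ℝ)
    (q : Measure Ξ) {T : ℕ} (x : Tree P T) (y : Tree Y T) : ℝ :=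
  outerExpectation (Measure.pi fun _ : Fin T => q) fun ξ =>
    (∑ e : Fin T → Bool,
      ⨆ θ : Θ, ∑ t : Fin T, signValue (e t) * ℓ ((x.node e t, ξ t), y.node e t) θ) / 2 ^ T

/-- The (distribution-dependent) sequential Rademacher complexity: the supremum over all trees `x`
of adversarial inputs and all trees `y` of admissible labels. -/
def seqRademacher {P Ξ Y Θ : Type*} [MeasurableSpace Ξ] (ℓ : (P × Ξ) × Y → Θ → ℝ)
    (labels : Set Y) (q : Measure Ξ) (T : ℕ) : ℝ :=
  sSup {r : ℝ | ∃ (x : Tree P T) (y : Tree Y T),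
    (∀ t s, y t s ∈ labels) ∧ r = seqRademacherOn ℓ q x y}

/-- The first `t` entries of a finite sequence. -/
def past {D : Type*} {T : ℕ} (z : Fin T → D) (t : Fin T) : Fin t → D :=
  fun j => z (Fin.castLE t.isLt.le j)

/-- An online learner: it maps a history of `n` data points of `D`, for every `n`, to a probability
distribution over the parameters. -/
structure Learner (D Θ : Type*) [MeasurableSpace D] [MeasurableSpace Θ] where
  predict : (n : ℕ) → Kernel (Fin n → D) Θ
  isMarkov : ∀ n, IsMarkovKernel (predict n)

/-- An adversary for `T` rounds. In round `t` it selects a point that may depend on the stochastic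
inputs `ξ` of the earlier rounds, then `ξ t` is drawn, and the adversary picks an admissible label
that may depend on `ξ t` as well. The learner is a fixed map from histories to distributions, so
the history and the learner's current distribution are functions of the past stochastic inputs, and
an adversary that reacts to them has this form. -/
structure Adversary (P Ξ Y : Type*) [MeasurableSpace P] [MeasurableSpace Ξ] [MeasurableSpace Y]
    (labels : Set Y) (T : ℕ) where
  point : Fin T → (Fin T → Ξ) → P
  label : Fin T → (Fin T → Ξ) → Y
  measurable_point : ∀ t, Measurable (point t)
  measurable_label : ∀ t, Measurable (label t)
  point_dependsOn : ∀ t, DependsOn (point t) (Set.Iio t)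
  label_dependsOn : ∀ t, DependsOn (label t) (Set.Iic t)
  label_mem : ∀ t ξ, label t ξ ∈ labels

/-- The data point `((x̄ₜ, ξₜ), yₜ)` of round `t`. -/
def Adversary.data {P Ξ Y : Type*} [MeasurableSpace P] [MeasurableSpace Ξ] [MeasurableSpace Y]
    {labels : Set Y} {T : ℕ} (A : Adversary P Ξ Y labels T) (ξ : Fin T → Ξ) (t : Fin T) :
    (P × Ξ) × Y :=
  ((A.point t ξ, ξ t), A.label t ξ)

/-- The expected regret of the learner `R` in `T` rounds against the adversary `A`:
`E [∑ₜ ℓ (dₜ) θₜ - inf_θ ∑ₜ ℓ (dₜ) θ]` with `ξₜ ∼ q` i.i.d. and `θₜ ∼ pₜ = R (d₁, …, dₜ₋₁)`. The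
data do not depend on the draws `θₜ`, so the expectation over `θₜ` is taken first. -/
def regret {P Ξ Y Θ : Type*} [MeasurableSpace P] [MeasurableSpace Ξ] [MeasurableSpace Y]
    [MeasurableSpace Θ] (ℓ : (P × Ξ) × Y → Θ → ℝ) (q : Measure Ξ) {labels : Set Y} {T : ℕ}
    (R : Learner ((P × Ξ) × Y) Θ) (A : Adversary P Ξ Y labels T) : ℝ :=
  outerExpectation (Measure.pi fun _ : Fin T => q) fun ξ =>
    (∑ t : Fin T, ∫ θ, ℓ (A.data ξ t) θ ∂(R.predict t (past (A.data ξ) t)))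
      - ⨅ θ : Θ, ∑ t : Fin T, ℓ (A.data ξ t) θ

/-- The learner has expected regret at most `2 𝕽_T` over `T` rounds against every adversary, where
`𝕽_T` is the sequential Rademacher complexity of the loss class. -/
def Learner.AchievesRademacherRegret {P Ξ Y Θ : Type*} [MeasurableSpace P] [MeasurableSpace Ξ]
    [MeasurableSpace Y] [MeasurableSpace Θ] (R : Learner ((P × Ξ) × Y) Θ)
    (ℓ : (P × Ξ) × Y → Θ → ℝ) (labels : Set Y) (q : Measure Ξ) (T : ℕ) : Prop :=
  ∀ A : Adversary P Ξ Y labels T, regret ℓ q R A ≤ 2 * seqRademacher ℓ labels q T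

end OnlineLearning

/-! ### Deterministic nonlinear bandits -/

namespace NonlinearBandit

open OnlineLearning

/-- The space `ℝ^d` of actions, with the Euclidean norm. -/
abbrev Action (d : ℕ) : Type := EuclideanSpace ℝ (Fin d)

/-- The Hessian of `f` at `a`, as a linear operator; its operator norm is the spectral norm. -/
def hessian {d : ℕ} (f : Action d → ℝ) (a : Action d) : Action d →L[ℝ] Action d :=
  fderiv ℝ (gradient f) a

/-- A reward class `η : Θ × ℝ^d → [0,1]`, twice continuously differentiable in the action, with
gradient bounded by `ζg`, Hessian bounded by `ζh`, and `ζ3`-Lipschitz Hessian. -/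
structure IsSmoothRewardClass {Θ : Type*} [MeasurableSpace Θ] {d : ℕ}
    (η : Θ → Action d → ℝ) (ζg ζh ζ3 : ℝ) : Prop where
  measurable : ∀ a, Measurable fun θ => η θ a
  mem_Icc : ∀ θ a, η θ a ∈ Set.Icc (0 : ℝ) 1
  contDiff : ∀ θ, ContDiff ℝ 2 (η θ)
  norm_gradient_le : ∀ θ a, ‖gradient (η θ) a‖ ≤ ζg
  norm_hessian_le : ∀ θ a, ‖hessian (η θ) a‖ ≤ ζh
  hessian_lipschitz : ∀ θ a₁ a₂, ‖hessian (η θ) a₁ - hessian (η θ) a₂‖ ≤ ζ3 * ‖a₁ - a₂‖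

/-- The `(εg, εh)`-approximate local maxima of `f`: the gradient has norm at most `εg` and the
largest eigenvalue of the Hessian is at most `εh`. -/
def approxLocalMaxima {d : ℕ} (f : Action d → ℝ) (εg εh : ℝ) : Set (Action d) :=
  {a | ‖gradient f a‖ ≤ εg ∧
    ∀ μ : ℝ, Module.End.HasEigenvalue (hessian f a : Action d →ₗ[ℝ] Action d) μ → μ ≤ εh}

/-- The `(εg, εh)`-local regret of the actions `a₁, …, a_T` for the reward function `f`. -/
def localRegret {d T : ℕ} (f : Action d → ℝ) (εg εh : ℝ) (a : Fin T → Action d) : ℝ :=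
  ∑ t : Fin T, ((⨅ b : approxLocalMaxima f εg εh, f b) - f (a t))

/-- The inputs `((a, a'), (u, v))` of the prediction task: the pair of actions is chosen by the
adversary, the pair of directions is random. -/
abbrev Input (d : ℕ) : Type := (Action d × Action d) × (Action d × Action d)

/-- The data points of the prediction task: an input and a label in `ℝ⁴`. -/
abbrev Datum (d : ℕ) : Type := Input d × (Fin 4 → ℝ)

/-- The output of the model `f` on an input: the rewards of `a` and of `a'`, and the random
projections `⟨∇f(a'), u⟩` and `⟨∇²f(a') u, v⟩`. -/
def output {d : ℕ} (f : Action d → ℝ) (x : Input d) : Fin 4 → ℝ :=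
  ![f x.1.1, f x.1.2, inner ℝ (gradient f x.1.2) x.2.1, inner ℝ (hessian f x.1.2 x.2.1) x.2.2]

/-- The admissible labels: rewards lie in `[0,1]`, projections of derivatives are arbitrary. -/
def labels : Set (Fin 4 → ℝ) :=
  {y | y 0 ∈ Set.Icc (0 : ℝ) 1 ∧ y 1 ∈ Set.Icc (0 : ℝ) 1}

/-- The loss of the prediction task, with clipping levels `κ₁ = 2 ζg` and `κ₂ = 640 √2 ζh`. -/
def loss {Θ : Type*} {d : ℕ} (η : Θ → Action d → ℝ) (ζg ζh : ℝ) (z : Datum d) (θ : Θ) : ℝ :=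
  (output (η θ) z.1 0 - z.2 0) ^ 2 + (output (η θ) z.1 1 - z.2 1) ^ 2
    + min ((2 * ζg) ^ 2) ((output (η θ) z.1 2 - z.2 2) ^ 2)
    + min ((640 * √2 * ζh) ^ 2) ((output (η θ) z.1 3 - z.2 3) ^ 2)

/-- The law of the random directions `(u, v)`: independent standard Gaussian vectors. -/
def noise (d : ℕ) : Measure (Action d × Action d) :=
  (stdGaussian (Action d)).prod (stdGaussian (Action d))

/-- The law of the random directions of `T` independent rounds. -/
def noiseSeq (d T : ℕ) : Measure (Fin T → Action d × Action d) :=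
  Measure.pi fun _ => noise d

/-- The sequential Rademacher complexity of the family of losses. -/
def rademacher {Θ : Type*} {d : ℕ} (η : Θ → Action d → ℝ) (ζg ζh : ℝ) (T : ℕ) : ℝ :=
  seqRademacher (loss η ζg ζh) labels (noise d) T

/-- The data point that ViOlin records in round `t + 1`, where `a 0, …, a T` are the actions, as
functions of the random directions `ξ`, and `f` is the real reward function: the input consists of
the current action, the previous action and the random directions, and the label is the output of
the real reward function. -/
def datum {d T : ℕ} (f : Action d → ℝ) (a : Fin (T + 1) → (Fin T → Action d × Action d) → Action d)
    (ξ : Fin T → Action d × Action d) (t : Fin T) : Datum d :=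
  (((a t.succ ξ, a t.castSucc ξ), ξ t), output f ((a t.succ ξ, a t.castSucc ξ), ξ t))

/-- `a 0, …, a T` are actions taken by ViOlin in `T` rounds with online learner `R`, initial action
`a₀`, reward class `η` and ground truth `θs`, as functions of the random directions `ξ`. In round
`t + 1` the learner computes a distribution from the data points of the previous rounds, and the
action `a (t + 1)` is a maximizer, chosen before the directions `ξ t` of this round are drawn, of
the expected virtual reward. Ties are broken in an arbitrary (measurable) way. -/
structure IsViOlinRun {Θ : Type*} [MeasurableSpace Θ] {d T : ℕ} (η : Θ → Action d → ℝ) (θs : Θ)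
    (R : Learner (Datum d) Θ) (a₀ : Action d)
    (a : Fin (T + 1) → (Fin T → Action d × Action d) → Action d) : Prop where
  init : ∀ ξ, a 0 ξ = a₀
  measurable : ∀ t, Measurable (a t)
  dependsOn : ∀ t : Fin T, DependsOn (a t.succ) (Set.Iio t)
  isMaxOn : ∀ (t : Fin T) (ξ : Fin T → Action d × Action d),
    IsMaxOn (fun b => ∫ θ, η θ b ∂(R.predict t (past (datum (η θs) a ξ) t))) Set.univ
      (a t.succ ξ)

end NonlinearBandit

end

noncomputable section

/-! Optimism is not needed: maximizing the mean virtual reward either improves the real reward or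
exposes a prediction error, and the online learner caps the total of these errors.

Let `B` be the expected loss of the prediction `p` at the pair `(a', a)` of current and previous
action. Gaussian projections detect a gradient and a quadratic form even after clipping, so by
Jensen the `p`-means of the rewards at `a'` and `a`, and of slope and curvature at `a` in any unit
direction, are within `O(√B)` of the real values (`abs_mean_errors_le`). If `a` is not an
approximate local maximum, a step along the real gradient or along an eigenvector of the real
Hessian raises the virtual reward. The maximizer `a'` does at least as well virtually, and going
back to the real reward gives a gain `δ - C₁ √(2B)`; at any `a` the loss of reward is at most `C₁
√(2B)` (`improvement`).

Real rewards lie in `[0,1]`, so these gains telescope to `δ * REG ≤ 1 + C₁ ∑ √(2 Bₜ)`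
(`sum_regret_le`). The ground truth has zero loss, hence the learner's regret is its total loss and
`∑ E Bₜ ≤ 2 𝕽_T` (`sum_integral_roundLoss_le`). The passage from the loss of a round to `Bₜ`
averages over the fresh directions, on which actions and prediction do not depend
(`integral_integral_update`). Jensen and Cauchy–Schwarz then bound the sum of square roots. -/

/-! ### Clipped second moment of a standard Gaussian variable -/

theorem hasDerivAt_id_mul_gaussianPDFReal (x : ℝ) :
    HasDerivAt (fun x => x * gaussianPDFReal 0 1 x) (gaussianPDFReal 0 1 x * (1 - x ^ 2)) x := by
  have h1 : HasDerivAt (fun x : ℝ => -(x - 0) ^ 2 / (2 * ((1 : NNReal) : ℝ))) (-x) x := by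
    have := ((((hasDerivAt_id x).sub_const 0).pow 2).neg).div_const (2 * ((1 : NNReal) : ℝ))
    refine this.congr_deriv ?_
    simp
    ring
  have h2 := (hasDerivAt_id x).mul ((h1.exp).const_mul (√(2 * Real.pi * ((1 : NNReal) : ℝ)))⁻¹)
  refine h2.congr_deriv ?_
  simp only [gaussianPDFReal, id]
  ring

/-- The square of the density at `1` is `1 / (2πe)`, and `2πe > 16`. -/
theorem gaussianPDFReal_zero_one_one_le : gaussianPDFReal 0 1 1 ≤ 1 / 4 := by
  have hsq : (gaussianPDFReal 0 1 1) ^ 2 ≤ (1 / 4) ^ 2 := by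
    simp only [gaussianPDFReal, NNReal.coe_one, mul_one, mul_pow, inv_pow]
    rw [Real.sq_sqrt (by positivity), ← Real.exp_nat_mul]
    have he : Real.exp (((2 : ℕ) : ℝ) * (-(1 - 0) ^ 2 / 2)) = (Real.exp 1)⁻¹ := by
      rw [← Real.exp_neg]; norm_num
    rw [he, ← mul_inv, inv_le_comm₀ (by positivity) (by positivity)]
    have h1 := Real.pi_gt_d2
    have h2 := Real.exp_one_gt_d9
    norm_num
    nlinarith
  exact le_of_sq_le_sq hsq (by norm_num)

/-- With `φ` the density, `x φ(x)` is an antiderivative of `(1 - x²) φ(x)`, so the integral equals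
`1 - 2 φ(1)`. -/
theorem half_le_integral_min_one_sq_gaussianReal :
    1 / 2 ≤ ∫ z, min 1 (z ^ 2) ∂(gaussianReal 0 1) := by
  have hind : ∀ z : ℝ, min 1 (z ^ 2) = 1 - (Set.Ioc (-1) 1).indicator (fun z => 1 - z ^ 2) z := by
    intro z
    by_cases hz : z ∈ Set.Ioc (-1 : ℝ) 1
    · rw [Set.indicator_of_mem hz, min_eq_right]
      · ring
      · nlinarith [hz.1, hz.2]
    · rw [Set.indicator_of_notMem hz, min_eq_left, sub_zero]
      rw [Set.mem_Ioc, not_and_or, not_lt, not_le] at hz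
      rcases hz with hz | hz <;> nlinarith
  have hint : Integrable ((Set.Ioc (-1 : ℝ) 1).indicator (fun z => 1 - z ^ 2))
      (gaussianReal 0 1) := by
    refine Integrable.of_bound ?_ 1 (ae_of_all _ fun z => ?_)
    · exact (Measurable.indicator (by fun_prop) measurableSet_Ioc).aestronglyMeasurable
    · by_cases hz : z ∈ Set.Ioc (-1 : ℝ) 1
      · rw [Set.indicator_of_mem hz, Real.norm_eq_abs, abs_le]
        constructor <;> nlinarith [hz.1, hz.2]
      · rw [Set.indicator_of_notMem hz]; simp
  simp_rw [hind]
  rw [integral_sub (integrable_const _) hint, integral_gaussianReal_eq_integral_smul one_ne_zero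
    (f := (Set.Ioc (-1 : ℝ) 1).indicator (fun z => 1 - z ^ 2))]
  have h1 : (fun x => gaussianPDFReal 0 1 x • (Set.Ioc (-1 : ℝ) 1).indicator (fun z => 1 - z ^ 2) x)
      = (Set.Ioc (-1 : ℝ) 1).indicator (fun x => gaussianPDFReal 0 1 x * (1 - x ^ 2)) := by
    ext x
    by_cases hx : x ∈ Set.Ioc (-1 : ℝ) 1 <;> simp [hx]
  have hc : Continuous (fun x => gaussianPDFReal 0 1 x * (1 - x ^ 2)) := by
    unfold gaussianPDFReal; fun_prop
  rw [h1, integral_indicator measurableSet_Ioc, ← intervalIntegral.integral_of_le (by norm_num),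
    intervalIntegral.integral_eq_sub_of_hasDerivAt
      (fun x _ => hasDerivAt_id_mul_gaussianPDFReal x) (hc.intervalIntegrable _ _)]
  have h2 : gaussianPDFReal 0 1 (-1) = gaussianPDFReal 0 1 1 := by simp [gaussianPDFReal]
  rw [h2]
  have := gaussianPDFReal_zero_one_one_le
  simp
  linarith

/-! ### Clipped Gaussian projections of vectors and operators -/

section Gaussian

variable {E : Type*} [NormedAddCommGroup E] [InnerProductSpace ℝ E] [FiniteDimensional ℝ E]
  [MeasurableSpace E] [BorelSpace E]

theorem stdGaussian_map_inner {e : E} (he : ‖e‖ = 1) :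
    (stdGaussian E).map (fun v => inner ℝ e v) = gaussianReal 0 1 := by
  have h := IsGaussian.map_eq_gaussianReal (μ := stdGaussian E) (innerSL ℝ e)
  rw [integral_strongDual_stdGaussian, variance_dual_stdGaussian, innerSL_apply_norm, he] at h
  simpa using h

/-- Write `w = ‖w‖ e`. Clipping is supermultiplicative, `min(K², ‖w‖² z²) ≥ min(K², ‖w‖²) min(1,
z²)`, and `z = ⟨e, v⟩` is a standard Gaussian variable. -/
theorem half_min_sq_norm_le_integral_stdGaussian (K : ℝ) (w : E) :
    1 / 2 * min (K ^ 2) (‖w‖ ^ 2) ≤ ∫ v, min (K ^ 2) ((inner ℝ w v) ^ 2) ∂(stdGaussian E) := by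
  have hmeas : ∀ (w : E) (K : ℝ), Integrable (fun v => min (K ^ 2) ((inner ℝ w v) ^ 2))
      (stdGaussian E) := fun w K => by
    refine Integrable.of_bound (Measurable.aestronglyMeasurable (by fun_prop)) (K ^ 2)
      (ae_of_all _ fun v => ?_)
    rw [Real.norm_of_nonneg (le_min (sq_nonneg _) (sq_nonneg _))]
    exact min_le_left _ _
  rcases eq_or_ne w 0 with rfl | hw
  · simp [sq_nonneg]
  have hw' : 0 < ‖w‖ := norm_pos_iff.2 hw
  have he : ‖(‖w‖⁻¹ • w)‖ = 1 := by
    rw [norm_smul, norm_inv, norm_norm, inv_mul_cancel₀ hw'.ne']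
  set e := ‖w‖⁻¹ • w with hedef
  have hwe : w = ‖w‖ • e := by rw [hedef, smul_smul, mul_inv_cancel₀ hw'.ne', one_smul]
  have h1 : ∫ v, min 1 ((inner ℝ e v) ^ 2) ∂(stdGaussian E)
      = ∫ z, min 1 (z ^ 2) ∂(gaussianReal 0 1) := by
    rw [← stdGaussian_map_inner he, integral_map]
    · exact Measurable.aemeasurable (by fun_prop)
    · exact Measurable.aestronglyMeasurable (by fun_prop)
  have h2 := half_le_integral_min_one_sq_gaussianReal
  rw [← h1] at h2
  have hi : Integrable (fun v => min 1 ((inner ℝ e v) ^ 2)) (stdGaussian E) := by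
    simpa using hmeas e 1
  calc 1 / 2 * min (K ^ 2) (‖w‖ ^ 2)
      ≤ min (K ^ 2) (‖w‖ ^ 2) * ∫ v, min 1 ((inner ℝ e v) ^ 2) ∂(stdGaussian E) := by
        rw [mul_comm]
        exact mul_le_mul_of_nonneg_left h2 (le_min (sq_nonneg _) (sq_nonneg _))
    _ = ∫ v, min (K ^ 2) (‖w‖ ^ 2) * min 1 ((inner ℝ e v) ^ 2) ∂(stdGaussian E) :=
        (integral_const_mul _ _).symm
    _ ≤ _ := by
        refine integral_mono (hi.const_mul _) (hmeas w K) fun v => ?_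
        have hv : inner ℝ w v = ‖w‖ * inner ℝ e v := by
          conv_lhs => rw [hwe, real_inner_smul_left]
        have hm : 0 ≤ min 1 ((inner ℝ e v) ^ 2) := le_min zero_le_one (sq_nonneg _)
        refine le_min ?_ ?_
        · calc _ ≤ K ^ 2 * 1 := mul_le_mul (min_le_left _ _) (min_le_left _ _) hm (sq_nonneg _)
            _ = _ := mul_one _
        · rw [hv, mul_pow]
          exact mul_le_mul (min_le_right _ _) (min_le_right _ _) hm (sq_nonneg _)

/-- Random bilinear projections detect the quadratic form of an operator, even after clipping. -/
theorem quarter_sq_le_integral_stdGaussian_prod (K : ℝ) (D : E →L[ℝ] E) (hD : ‖D‖ ≤ K) {e : E}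
    (he : ‖e‖ = 1) :
    1 / 4 * (inner ℝ (D e) e) ^ 2 ≤
      ∫ w, min (K ^ 2) ((inner ℝ (D w.1) w.2) ^ 2) ∂((stdGaussian E).prod (stdGaussian E)) := by
  have hbd : ∀ x : ℝ, ‖min (K ^ 2) (x ^ 2)‖ ≤ K ^ 2 := fun x => by
    rw [Real.norm_of_nonneg (le_min (sq_nonneg _) (sq_nonneg _))]
    exact min_le_left _ _
  have hi : Integrable (fun w : E × E => min (K ^ 2) ((inner ℝ (D w.1) w.2) ^ 2))
      ((stdGaussian E).prod (stdGaussian E)) :=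
    Integrable.of_bound (Measurable.aestronglyMeasurable
      (Continuous.measurable (by fun_prop))) (K ^ 2) (ae_of_all _ fun v => hbd _)
  rw [integral_prod _ hi]
  have hK : 0 ≤ K := (norm_nonneg D).trans hD
  -- The vector bound is applied twice: over `v` with `u` fixed it yields `‖D u‖`, which dominates
  -- `|⟨e, D u⟩| = |⟨D* e, u⟩|`; over `u` it then yields `‖D* e‖ ≥ |⟨D e, e⟩|`. Since `‖D* e‖ ≤ K`,
  -- the final clipping is inactive.
  set w := ContinuousLinearMap.adjoint D e with hw
  have hwn : ‖w‖ ≤ K := by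
    refine (ContinuousLinearMap.le_opNorm _ _).trans ?_
    rw [he, mul_one, LinearIsometryEquiv.norm_map]
    exact hD
  have hDw : ∀ u, inner ℝ w u = inner ℝ e (D u) := fun u =>
    ContinuousLinearMap.adjoint_inner_left D u e
  have h1 : (inner ℝ (D e) e) ^ 2 ≤ ‖w‖ ^ 2 := by
    rw [real_inner_comm, ← hDw, ← sq_abs]
    refine pow_le_pow_left₀ (abs_nonneg _) ?_ 2
    simpa [he] using abs_real_inner_le_norm w e
  have h2 := half_min_sq_norm_le_integral_stdGaussian K w
  rw [min_eq_right (pow_le_pow_left₀ (norm_nonneg _) hwn 2)] at h2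
  have hi' : Integrable (fun u => min (K ^ 2) ((inner ℝ w u) ^ 2)) (stdGaussian E) :=
    Integrable.of_bound (Measurable.aestronglyMeasurable (by fun_prop)) (K ^ 2)
      (ae_of_all _ fun v => hbd _)
  calc 1 / 4 * (inner ℝ (D e) e) ^ 2
      ≤ 1 / 2 * ∫ u, min (K ^ 2) ((inner ℝ w u) ^ 2) ∂(stdGaussian E) := by linarith
    _ = ∫ u, 1 / 2 * min (K ^ 2) ((inner ℝ w u) ^ 2) ∂(stdGaussian E) :=
        (integral_const_mul _ _).symm
    _ ≤ _ := by
        refine integral_mono (hi'.const_mul _) hi.integral_prod_left fun u => ?_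
        refine le_trans ?_ (half_min_sq_norm_le_integral_stdGaussian K (D u))
        refine mul_le_mul_of_nonneg_left (min_le_min_left _ ?_) (by norm_num)
        rw [hDw, ← sq_abs]
        refine pow_le_pow_left₀ (abs_nonneg _) ?_ 2
        simpa [he] using abs_real_inner_le_norm e (D u)

end Gaussian

/-! ### Resampling a coordinate, Jensen's inequality, Taylor bounds -/

/-- Integrating out a coordinate of a product measure once more does not change the integral. -/
theorem measurePreserving_update {ι α : Type*} [Fintype ι] [DecidableEq ι] [MeasurableSpace α]
    (q : Measure α) [IsProbabilityMeasure q] (i : ι) :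
    MeasurePreserving (fun p : (ι → α) × α => Function.update p.1 i p.2)
      ((Measure.pi fun _ => q).prod q) (Measure.pi fun _ => q) := by
  have hm : Measurable (fun p : (ι → α) × α => Function.update p.1 i p.2) := by
    refine measurable_pi_iff.2 fun j => ?_
    by_cases h : j = i
    · subst h; simpa using measurable_snd
    · simp only [Function.update_of_ne h]
      exact (measurable_pi_apply j).comp measurable_fst
  refine ⟨hm, (Measure.pi_eq fun s hs => ?_).symm⟩
  rw [Measure.map_apply hm (MeasurableSet.univ_pi hs)]
  -- The preimage of a box is a box: the constraint on coordinate `i` moves to the fresh variable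
  -- and the old coordinate becomes free.
  have : (fun p : (ι → α) × α => Function.update p.1 i p.2) ⁻¹' Set.univ.pi s
      = (Set.univ.pi (Function.update s i Set.univ)) ×ˢ s i := by
    ext ⟨x, y⟩
    simp only [Set.mem_preimage, Set.mem_pi, Set.mem_univ, true_imp_iff, Set.mem_prod]
    constructor
    · refine fun h => ⟨fun j => ?_, by simpa using h i⟩
      by_cases hj : j = i
      · subst hj; simp
      · simpa [Function.update_of_ne hj] using h j
    · rintro ⟨h, h'⟩ j
      by_cases hj : j = i
      · subst hj; simpa using h'
      · simpa [Function.update_of_ne hj] using h j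
  rw [this, Measure.prod_prod, Measure.pi_pi, ← Finset.mul_prod_erase Finset.univ _
    (Finset.mem_univ i), ← Finset.mul_prod_erase Finset.univ (fun i => q (s i))
    (Finset.mem_univ i), mul_comm]
  simp only [Function.update_self, measure_univ, one_mul]
  congr 1
  refine Finset.prod_congr rfl fun j hj => ?_
  rw [Function.update_of_ne (Finset.ne_of_mem_erase hj)]

/-- This stands in for conditioning on the past: averaging over a fresh copy of `ξ i` keeps the
total mean. -/
theorem integral_integral_update {ι α : Type*} [Fintype ι] [DecidableEq ι] [MeasurableSpace α]
    (q : Measure α) [IsProbabilityMeasure q] (i : ι) {G : (ι → α) → ℝ}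
    (hG : Integrable G (Measure.pi fun _ => q)) :
    Integrable (fun ξ => ∫ w, G (Function.update ξ i w) ∂q) (Measure.pi fun _ => q) ∧
    ∫ ξ, ∫ w, G (Function.update ξ i w) ∂q ∂(Measure.pi fun _ => q)
      = ∫ ξ, G ξ ∂(Measure.pi fun _ => q) := by
  have hmp := measurePreserving_update q i
  have hi : Integrable (fun p : (ι → α) × α => G (Function.update p.1 i p.2))
      ((Measure.pi fun _ => q).prod q) := hmp.integrable_comp_of_integrable hG
  refine ⟨hi.integral_prod_left, ?_⟩
  rw [← integral_prod _ hi,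
    ← integral_map hmp.measurable.aemeasurable (hmp.map_eq.symm ▸ hG.1), hmp.map_eq]

/-- Jensen's inequality for the square. -/
theorem abs_integral_le_of_integral_sq_le {Ω : Type*} [MeasurableSpace Ω] {μ : Measure Ω}
    [IsProbabilityMeasure μ] {f : Ω → ℝ} {c : ℝ} (hf : AEStronglyMeasurable f μ)
    (hf2 : Integrable (fun x => f x ^ 2) μ) (h : ∫ x, f x ^ 2 ∂μ ≤ c) :
    |∫ x, f x ∂μ| ≤ √c := by
  have hL : MemLp f 2 μ := (memLp_two_iff_integrable_sq hf).2 hf2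
  have hv := variance_nonneg f μ
  rw [variance_eq_sub hL] at hv
  refine Real.abs_le_sqrt ?_
  have : μ[f ^ 2] = ∫ x, f x ^ 2 ∂μ := rfl
  linarith

/-- A function on `[0, ∞)` whose second derivative is at least `c - k s` lies above the
corresponding cubic. -/
theorem cubic_le_of_deriv2_ge {φ φ' φ'' : ℝ → ℝ} (h1 : ∀ s, HasDerivAt φ (φ' s) s)
    (h2 : ∀ s, HasDerivAt φ' (φ'' s) s) {c k : ℝ} (h : ∀ s, 0 ≤ s → c - k * s ≤ φ'' s) {s : ℝ}
    (hs : 0 ≤ s) : φ 0 + s * φ' 0 + c * s ^ 2 / 2 - k * s ^ 3 / 6 ≤ φ s := by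
  -- Used twice, for `φ'` minus its quadratic minorant and then for `φ` minus its cubic one.
  have key : ∀ ψ ψ' : ℝ → ℝ, (∀ s, HasDerivAt ψ (ψ' s) s) → (∀ s, 0 ≤ s → 0 ≤ ψ' s) →
      ∀ s, 0 ≤ s → ψ 0 ≤ ψ s := by
    intro ψ ψ' hd hn s hs
    have : MonotoneOn ψ (Set.Ici 0) := by
      refine monotoneOn_of_deriv_nonneg (convex_Ici 0)
        (fun x _ => (hd x).continuousAt.continuousWithinAt)
        (fun x _ => (hd x).differentiableAt.differentiableWithinAt) fun x hx => ?_
      rw [(hd x).deriv]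
      rw [interior_Ici] at hx
      exact hn x hx.le
    exact this (Set.mem_Ici.2 le_rfl) hs hs
  have hA : ∀ s, 0 ≤ s → φ' 0 + c * s - k * s ^ 2 / 2 ≤ φ' s := fun s hs => by
    have := key (fun s => φ' s - (c * s - k * s ^ 2 / 2)) (fun s => φ'' s - (c - k * s))
      (fun s => by
        refine (h2 s).sub ((((hasDerivAt_id s).const_mul c).sub
          ((((hasDerivAt_id s).pow 2).const_mul k).div_const 2)).congr_deriv ?_)
        simp; ring)
      (fun s hs => sub_nonneg.2 (h s hs)) s hs
    simp at this
    linarith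
  have := key (fun s => φ s - (s * φ' 0 + c * s ^ 2 / 2 - k * s ^ 3 / 6))
    (fun s => φ' s - (φ' 0 + c * s - k * s ^ 2 / 2))
    (fun s => by
      refine (h1 s).sub (((((hasDerivAt_id s).mul_const (φ' 0)).add
        ((((hasDerivAt_id s).pow 2).const_mul c).div_const 2)).sub
          ((((hasDerivAt_id s).pow 3).const_mul k).div_const 6)).congr_deriv ?_)
      simp; ring)
    (fun s hs => sub_nonneg.2 (hA s hs)) s hs
  simp at this
  linarith


/-- A derivative with respect to a real parameter is measurable in the remaining variables. -/
theorem measurable_of_hasDerivAt_zero {X : Type*} [MeasurableSpace X] {h : X → ℝ → ℝ} {h' : X → ℝ}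
    (hm : ∀ s, Measurable fun x => h x s) (hd : ∀ x, HasDerivAt (h x) (h' x) 0) :
    Measurable h' := by
  refine measurable_of_tendsto_metrizable
    (f := fun (n : ℕ) x => ((1 : ℝ) / (n + 1))⁻¹ • (h x (0 + 1 / (n + 1)) - h x 0))
    (fun n => (((hm (0 + 1 / (n + 1))).sub (hm 0)).const_smul ((1 : ℝ) / (n + 1))⁻¹))
    (tendsto_pi_nhds.2 fun x => ?_)
  refine (hasDerivAt_iff_tendsto_slope_zero.1 (hd x)).comp ?_
  refine tendsto_nhdsWithin_iff.2 ⟨tendsto_one_div_add_atTop_nhds_zero_nat,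
    Filter.Eventually.of_forall fun n => ?_⟩
  have : (0 : ℝ) < 1 / (n + 1) := by positivity
  exact this.ne'

/-- If the square of `X` is dominated by `c L`, then the mean of `X` is at most `√(c E L)`. -/
theorem abs_integral_le_of_sq_le {Ω : Type*} [MeasurableSpace Ω] {μ : Measure Ω}
    [IsProbabilityMeasure μ] {X L : Ω → ℝ} {c B : ℝ} (hX : Measurable X) (hL : Integrable L μ)
    (hB : ∫ x, L x ∂μ = B) (h : ∀ x, X x ^ 2 ≤ c * L x) : |∫ x, X x ∂μ| ≤ √(c * B) := by
  have hi : Integrable (fun x => X x ^ 2) μ := by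
    refine (hL.const_mul c).mono' (hX.pow_const 2).aestronglyMeasurable (ae_of_all _ fun x => ?_)
    rw [Real.norm_of_nonneg (sq_nonneg _)]
    exact h x
  refine abs_integral_le_of_integral_sq_le hX.aestronglyMeasurable hi ?_
  rw [← hB, ← integral_const_mul]
  exact integral_mono hi (hL.const_mul c) h

namespace NonlinearBandit

open OnlineLearning

/-! ### Derivatives along lines -/

section Calculus

variable {d : ℕ} {f : Action d → ℝ}

theorem contDiff_gradient (hf : ContDiff ℝ 2 f) : ContDiff ℝ 1 (gradient f) :=
  ((InnerProductSpace.toDual ℝ (Action d)).symm.toContinuousLinearEquiv.contDiff).comp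
    (hf.fderiv_right (m := 1) (by norm_num))

theorem hasDerivAt_line (a e : Action d) (s : ℝ) : HasDerivAt (fun s : ℝ => a + s • e) e s := by
  simpa using ((hasDerivAt_id s).smul_const e).const_add a

theorem hasDerivAt_comp_line (hf : ContDiff ℝ 2 f) (a e : Action d) (s : ℝ) :
    HasDerivAt (fun s : ℝ => f (a + s • e)) (inner ℝ (gradient f (a + s • e)) e) s := by
  have h := ((hf.differentiable (by norm_num) (a + s • e)).hasFDerivAt).comp_hasDerivAt s
    (hasDerivAt_line a e s)
  rwa [← inner_gradient_left] at h

theorem hasDerivAt_inner_gradient_line (hf : ContDiff ℝ 2 f) (a e v : Action d) (s : ℝ) :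
    HasDerivAt (fun s : ℝ => inner ℝ (gradient f (a + s • e)) v)
      (inner ℝ (hessian f (a + s • e) e) v) s := by
  have h := (((contDiff_gradient hf).differentiable (by norm_num)
    (a + s • e)).hasFDerivAt).comp_hasDerivAt s (hasDerivAt_line a e s)
  have h2 := h.inner ℝ (hasDerivAt_const s v)
  simpa [hessian] using h2

end Calculus

/-! ### Taylor bounds and measurability for the reward class, and what the loss controls -/

section RewardClass

variable {Θ : Type*} [MeasurableSpace Θ] {d : ℕ} {η : Θ → Action d → ℝ} {ζg ζh ζ3 : ℝ}

/-- Second-order lower bound for a step of length `s` in the direction `e`. -/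
theorem IsSmoothRewardClass.quadratic_le (hη : IsSmoothRewardClass η ζg ζh ζ3) (θ : Θ)
    (a : Action d) {e : Action d} (he : ‖e‖ = 1) {s : ℝ} (hs : 0 ≤ s) :
    η θ a + s * inner ℝ (gradient (η θ) a) e - ζh * s ^ 2 / 2 ≤ η θ (a + s • e) := by
  have h := cubic_le_of_deriv2_ge (hasDerivAt_comp_line (hη.contDiff θ) a e)
    (hasDerivAt_inner_gradient_line (hη.contDiff θ) a e e) (c := -ζh) (k := 0)
    (fun s _ => by
      have h1 := abs_real_inner_le_norm (hessian (η θ) (a + s • e) e) e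
      have h2 := (hessian (η θ) (a + s • e)).le_opNorm e
      have h3 := hη.norm_hessian_le θ (a + s • e)
      rw [he, mul_one] at h1 h2
      have h4 := (abs_le.1 (h1.trans (h2.trans h3))).1
      linarith) hs
  simp only [zero_smul, add_zero] at h
  linarith

/-- Third-order lower bound for a step of length `s` in the direction `e`. -/
theorem IsSmoothRewardClass.cubic_le (hη : IsSmoothRewardClass η ζg ζh ζ3) (θ : Θ)
    (a : Action d) {e : Action d} (he : ‖e‖ = 1) {s : ℝ} (hs : 0 ≤ s) :
    η θ a + s * inner ℝ (gradient (η θ) a) e + s ^ 2 / 2 * inner ℝ (hessian (η θ) a e) e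
      - ζ3 * s ^ 3 / 6 ≤ η θ (a + s • e) := by
  have h := cubic_le_of_deriv2_ge (hasDerivAt_comp_line (hη.contDiff θ) a e)
    (hasDerivAt_inner_gradient_line (hη.contDiff θ) a e e)
    (c := inner ℝ (hessian (η θ) a e) e) (k := ζ3)
    (fun s hs => by
      have h1 := abs_real_inner_le_norm ((hessian (η θ) (a + s • e) - hessian (η θ) a) e) e
      have h2 := (hessian (η θ) (a + s • e) - hessian (η θ) a).le_opNorm e
      have h3 := hη.hessian_lipschitz θ (a + s • e) a
      rw [add_sub_cancel_left, norm_smul, he, mul_one, Real.norm_of_nonneg hs] at h3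
      rw [he, mul_one] at h1 h2
      have h4 := (abs_le.1 (h1.trans (h2.trans h3))).1
      rw [sub_apply, inner_sub_left] at h4
      linarith) hs
  simp only [zero_smul, add_zero] at h
  linarith

theorem IsSmoothRewardClass.continuous (hη : IsSmoothRewardClass η ζg ζh ζ3) (θ : Θ) :
    Continuous (η θ) := (hη.contDiff θ).continuous

theorem IsSmoothRewardClass.measurable_uncurry (hη : IsSmoothRewardClass η ζg ζh ζ3) :
    Measurable fun p : Θ × Action d => η p.1 p.2 :=
  (measurable_uncurry_of_continuous_of_measurable (u := fun a θ => η θ a)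
    (fun θ => hη.continuous θ) hη.measurable).comp measurable_swap

/-- Measurability in `θ` is assumed only for rewards. Derivatives inherit it, jointly in all
variables, as limits of difference quotients. -/
theorem IsSmoothRewardClass.measurable_inner_gradient (hη : IsSmoothRewardClass η ζg ζh ζ3) :
    Measurable fun p : Θ × Action d × Action d => inner ℝ (gradient (η p.1) p.2.1) p.2.2 :=
  measurable_of_hasDerivAt_zero (h := fun p s => η p.1 (p.2.1 + s • p.2.2))
    (fun s => hη.measurable_uncurry.comp
      (f := fun p : Θ × Action d × Action d => (p.1, p.2.1 + s • p.2.2)) (by fun_prop))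
    (fun p => by simpa using hasDerivAt_comp_line (hη.contDiff p.1) p.2.1 p.2.2 0)

theorem IsSmoothRewardClass.measurable_inner_hessian (hη : IsSmoothRewardClass η ζg ζh ζ3) :
    Measurable fun p : Θ × Action d × Action d × Action d =>
      inner ℝ (hessian (η p.1) p.2.1 p.2.2.1) p.2.2.2 :=
  measurable_of_hasDerivAt_zero
    (h := fun p s => inner ℝ (gradient (η p.1) (p.2.1 + s • p.2.2.1)) p.2.2.2)
    (fun s => hη.measurable_inner_gradient.comp
      (f := fun p : Θ × Action d × Action d × Action d => (p.1, p.2.1 + s • p.2.2.1, p.2.2.2))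
      (by fun_prop))
    (fun p => by
      simpa using hasDerivAt_inner_gradient_line (hη.contDiff p.1) p.2.1 p.2.2.1 p.2.2.2 0)

theorem IsSmoothRewardClass.measurable_output (hη : IsSmoothRewardClass η ζg ζh ζ3) :
    Measurable fun p : Θ × Input d => output (η p.1) p.2 := by
  refine measurable_pi_iff.2 fun i => ?_
  fin_cases i
  · exact hη.measurable_uncurry.comp (f := fun p : Θ × Input d => (p.1, p.2.1.1)) (by fun_prop)
  · exact hη.measurable_uncurry.comp (f := fun p : Θ × Input d => (p.1, p.2.1.2)) (by fun_prop)
  · exact hη.measurable_inner_gradient.comp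
      (f := fun p : Θ × Input d => (p.1, p.2.1.2, p.2.2.1)) (by fun_prop)
  · exact hη.measurable_inner_hessian.comp
      (f := fun p : Θ × Input d => (p.1, p.2.1.2, p.2.2.1, p.2.2.2)) (by fun_prop)

theorem IsSmoothRewardClass.measurable_loss (hη : IsSmoothRewardClass η ζg ζh ζ3) :
    Measurable fun p : Datum d × Θ => loss η ζg ζh p.1 p.2 := by
  have h (i : Fin 4) : Measurable fun p : Datum d × Θ => output (η p.2) p.1.1 i :=
    (measurable_pi_apply i).comp (hη.measurable_output.comp
      (f := fun p : Datum d × Θ => (p.2, p.1.1)) (by fun_prop))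
  have h' (i : Fin 4) : Measurable fun p : Datum d × Θ => p.1.2 i :=
    (measurable_pi_apply i).comp (measurable_snd.comp measurable_fst)
  have hd (i : Fin 4) := ((h i).sub (h' i)).pow_const 2
  exact (((hd 0).add (hd 1)).add (measurable_const.min (hd 2))).add (measurable_const.min (hd 3))

theorem IsSmoothRewardClass.output_mem_labels (hη : IsSmoothRewardClass η ζg ζh ζ3) (θ : Θ)
    (x : Input d) : output (η θ) x ∈ labels :=
  ⟨hη.mem_Icc θ x.1.1, hη.mem_Icc θ x.1.2⟩

theorem loss_nonneg {Θ : Type*} {d : ℕ} {η : Θ → Action d → ℝ} {ζg ζh : ℝ}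
    (z : Datum d) (θ : Θ) : 0 ≤ loss η ζg ζh z θ := by
  unfold loss; positivity

/-- Clipping bounds the loss although the Gaussian projections are unbounded; the integrability of
the losses rests on this. -/
theorem IsSmoothRewardClass.loss_le (hη : IsSmoothRewardClass η ζg ζh ζ3) {z : Datum d}
    (hz : z.2 ∈ labels) (θ : Θ) :
    loss η ζg ζh z θ ≤ 2 + (2 * ζg) ^ 2 + (640 * √2 * ζh) ^ 2 := by
  have key {x y : ℝ} (hx : x ∈ Set.Icc (0 : ℝ) 1) (hy : y ∈ Set.Icc (0 : ℝ) 1) :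
      (x - y) ^ 2 ≤ 1 := by
    have h1 : x - y ≤ 1 := by linarith [hx.2, hy.1]
    have h2 : -1 ≤ x - y := by linarith [hx.1, hy.2]
    nlinarith
  have ho := hη.output_mem_labels θ z.1
  have h0 := key ho.1 hz.1
  have h1 := key ho.2 hz.2
  have h2 := min_le_left ((2 * ζg) ^ 2) ((output (η θ) z.1 2 - z.2 2) ^ 2)
  have h3 := min_le_left ((640 * √2 * ζh) ^ 2) ((output (η θ) z.1 3 - z.2 3) ^ 2)
  unfold loss
  linarith

theorem IsSmoothRewardClass.norm_loss_le (hη : IsSmoothRewardClass η ζg ζh ζ3) {z : Datum d}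
    (hz : z.2 ∈ labels) (θ : Θ) :
    ‖loss η ζg ζh z θ‖ ≤ 2 + (2 * ζg) ^ 2 + (640 * √2 * ζh) ^ 2 := by
  rw [Real.norm_of_nonneg (loss_nonneg z θ)]
  exact hη.loss_le hz θ

theorem loss_output_self {Θ : Type*} {d : ℕ} {η : Θ → Action d → ℝ} {ζg ζh : ℝ}
    (θ : Θ) (x : Input d) :
    loss η ζg ζh (x, output (η θ) x) θ = 0 := by
  simp [loss, sq_nonneg]

instance (d : ℕ) : IsProbabilityMeasure (noise d) := by unfold noise; infer_instance

/-- The expected loss of `θ` controls the errors of the reward and of its first two derivatives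
in any direction. -/
theorem IsSmoothRewardClass.sq_errors_le_integral_loss (hη : IsSmoothRewardClass η ζg ζh ζ3)
    (hζh : 0 < ζh) (θs θ : Θ) (a' a : Action d) {L : ℝ}
    (hL : ∫ w, loss η ζg ζh (((a', a), w), output (η θs) ((a', a), w)) θ ∂(noise d) = L) :
    (η θ a' - η θs a') ^ 2 ≤ L ∧ (η θ a - η θs a) ^ 2 ≤ L ∧
    ∀ e : Action d, ‖e‖ = 1 →
      (inner ℝ (gradient (η θ) a) e - inner ℝ (gradient (η θs) a) e) ^ 2 ≤ 2 * L ∧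
      (inner ℝ (hessian (η θ) a e) e - inner ℝ (hessian (η θs) a e) e) ^ 2 ≤ 4 * L := by
  have hmeas : Measurable fun w =>
      loss η ζg ζh (((a', a), w), output (η θs) ((a', a), w)) θ := by
    have h1 : Measurable fun w : Action d × Action d => output (η θs) ((a', a), w) :=
      hη.measurable_output.comp (f := fun w => (θs, ((a', a), w))) (by fun_prop)
    exact hη.measurable_loss.comp
      (f := fun w : Action d × Action d => ((((a', a), w), output (η θs) ((a', a), w)), θ))
      (by fun_prop)
  have hi : Integrable (fun w =>
      loss η ζg ζh (((a', a), w), output (η θs) ((a', a), w)) θ) (noise d) :=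
    Integrable.of_bound hmeas.aestronglyMeasurable _
      (ae_of_all _ fun w => hη.norm_loss_le (hη.output_mem_labels θs _) θ)
  have key {F : Action d × Action d → ℝ} (hF0 : ∀ w, 0 ≤ F w) (hF : Measurable F)
      (hle : ∀ w, F w ≤ loss η ζg ζh (((a', a), w), output (η θs) ((a', a), w)) θ) :
      ∫ w, F w ∂(noise d) ≤ L := by
    rw [← hL]
    refine integral_mono (hi.mono' hF.aestronglyMeasurable (ae_of_all _ fun w => ?_)) hi hle
    rw [Real.norm_of_nonneg (hF0 w)]
    exact hle w
  -- The projections are linear in the derivatives, so the loss sees only differences between `θ`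
  -- and `θs`.
  have hexp : ∀ w, loss η ζg ζh (((a', a), w), output (η θs) ((a', a), w)) θ
      = (η θ a' - η θs a') ^ 2 + (η θ a - η θs a) ^ 2
      + min ((2 * ζg) ^ 2) ((inner ℝ (gradient (η θ) a - gradient (η θs) a) w.1) ^ 2)
      + min ((640 * √2 * ζh) ^ 2)
          ((inner ℝ ((hessian (η θ) a - hessian (η θs) a) w.1) w.2) ^ 2) := by
    intro w
    rw [inner_sub_left, sub_apply, inner_sub_left]
    rfl
  have hp0 := sq_nonneg (η θ a' - η θs a')
  have hp1 := sq_nonneg (η θ a - η θs a)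
  have hp2 (w : Action d × Action d) :
      0 ≤ min ((2 * ζg) ^ 2) ((inner ℝ (gradient (η θ) a - gradient (η θs) a) w.1) ^ 2) := by
    positivity
  have hp3 (w : Action d × Action d) : 0 ≤ min ((640 * √2 * ζh) ^ 2)
      ((inner ℝ ((hessian (η θ) a - hessian (η θs) a) w.1) w.2) ^ 2) := by positivity
  refine ⟨?_, ?_, fun e he => ⟨?_, ?_⟩⟩
  · simpa using key (F := fun _ => (η θ a' - η θs a') ^ 2) (fun _ => hp0) measurable_const
      (fun w => by rw [hexp]; linarith [hp2 w, hp3 w])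
  · simpa using key (F := fun _ => (η θ a - η θs a) ^ 2) (fun _ => hp1) measurable_const
      (fun w => by rw [hexp]; linarith [hp2 w, hp3 w])
  · have h1 := key hp2 (Continuous.measurable (by fun_prop))
      (fun w => by rw [hexp]; linarith [hp2 w, hp3 w])
    have h2 := half_min_sq_norm_le_integral_stdGaussian (2 * ζg)
      (gradient (η θ) a - gradient (η θs) a)
    rw [noise, integral_fun_fst (f := fun u => min ((2 * ζg) ^ 2)
      ((inner ℝ (gradient (η θ) a - gradient (η θs) a) u) ^ 2))] at h1
    simp only [probReal_univ, one_smul] at h1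
    -- The level `κ₁ = 2 ζg` is exactly what keeps the clipping from affecting the norm of the
    -- difference.
    have h3 : ‖gradient (η θ) a - gradient (η θs) a‖ ≤ 2 * ζg := by
      refine (norm_sub_le _ _).trans ?_
      linarith [hη.norm_gradient_le θ a, hη.norm_gradient_le θs a]
    rw [min_eq_right (pow_le_pow_left₀ (norm_nonneg _) h3 2)] at h2
    rw [← inner_sub_left]
    have h4 := abs_real_inner_le_norm (gradient (η θ) a - gradient (η θs) a) e
    rw [he, mul_one] at h4
    have h5 := pow_le_pow_left₀ (abs_nonneg _) h4 2
    rw [sq_abs] at h5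
    linarith
  · have h1 := key hp3 (Continuous.measurable (by fun_prop))
      (fun w => by rw [hexp]; linarith [hp2 w, hp3 w])
    -- Only `κ₂ ≥ 2 ζh` matters here.
    have h3 : ‖hessian (η θ) a - hessian (η θs) a‖ ≤ 640 * √2 * ζh := by
      refine (norm_sub_le _ _).trans ?_
      have : 1 ≤ √2 := Real.one_le_sqrt.2 (by norm_num)
      nlinarith [hη.norm_hessian_le θ a, hη.norm_hessian_le θs a]
    have h2 := quarter_sq_le_integral_stdGaussian_prod _ _ h3 he
    rw [← inner_sub_left, ← sub_apply]
    rw [noise] at h1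
    linarith

end RewardClass
-- Improvement of the real reward in one round
section Improvement

variable {Θ : Type*} [MeasurableSpace Θ] {d : ℕ} {η : Θ → Action d → ℝ} {ζg ζh ζ3 : ℝ}

/-- The expected prediction loss of a distribution `p` over the parameters, at the current action
`a'` and the previous action `a`. -/
def expectedLoss (η : Θ → Action d → ℝ) (ζg ζh : ℝ) (θs : Θ) (p : Measure Θ) (a' a : Action d) :
    ℝ :=
  ∫ w, ∫ θ, loss η ζg ζh (((a', a), w), output (η θs) ((a', a), w)) θ ∂p ∂(noise d)

theorem expectedLoss_nonneg (θs : Θ) (p : Measure Θ) (a' a : Action d) :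
    0 ≤ expectedLoss η ζg ζh θs p a' a :=
  integral_nonneg fun _ => integral_nonneg fun _ => loss_nonneg _ _

/-- The mean errors of a distribution over the parameters are controlled by its expected loss. -/
theorem IsSmoothRewardClass.abs_mean_errors_le (hη : IsSmoothRewardClass η ζg ζh ζ3)
    (hζh : 0 < ζh) (θs : Θ) (p : Measure Θ) [IsProbabilityMeasure p] (a' a : Action d) {B : ℝ}
    (hB : expectedLoss η ζg ζh θs p a' a = B) :
    |∫ θ, (η θ a' - η θs a') ∂p| ≤ √B ∧ |∫ θ, (η θ a - η θs a) ∂p| ≤ √B ∧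
    ∀ e : Action d, ‖e‖ = 1 →
      |∫ θ, (inner ℝ (gradient (η θ) a) e - inner ℝ (gradient (η θs) a) e) ∂p| ≤ √(2 * B) ∧
      |∫ θ, (inner ℝ (hessian (η θ) a e) e - inner ℝ (hessian (η θs) a e) e) ∂p| ≤ √(4 * B) := by
  have hmeas : Measurable fun q : (Action d × Action d) × Θ =>
      loss η ζg ζh (((a', a), q.1), output (η θs) ((a', a), q.1)) q.2 := by
    have h1 : Measurable fun q : (Action d × Action d) × Θ => output (η θs) ((a', a), q.1) :=
      hη.measurable_output.comp
        (f := fun q : (Action d × Action d) × Θ => (θs, ((a', a), q.1))) (by fun_prop)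
    exact hη.measurable_loss.comp (f := fun q : (Action d × Action d) × Θ =>
      ((((a', a), q.1), output (η θs) ((a', a), q.1)), q.2)) (by fun_prop)
  have hi : Integrable (fun q : (Action d × Action d) × Θ =>
      loss η ζg ζh (((a', a), q.1), output (η θs) ((a', a), q.1)) q.2) ((noise d).prod p) :=
    Integrable.of_bound hmeas.aestronglyMeasurable _
      (ae_of_all _ fun q => hη.norm_loss_le (hη.output_mem_labels θs _) q.2)
  have hL := hi.integral_prod_right
  -- Fubini: the squared errors are bounded for each fixed `θ` by averaging over the directions, and
  -- only afterwards averaged over `p`.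
  have hBL : ∫ θ, ∫ w, loss η ζg ζh (((a', a), w), output (η θs) ((a', a), w)) θ ∂(noise d) ∂p
      = B := by
    rw [← hB, expectedLoss, integral_integral_swap (f := fun w θ =>
      loss η ζg ζh (((a', a), w), output (η θs) ((a', a), w)) θ) hi]
  have hsq := fun θ => hη.sq_errors_le_integral_loss hζh θs θ a' a rfl
  have hg (e : Action d) : Measurable fun θ => inner ℝ (gradient (η θ) a) e :=
    hη.measurable_inner_gradient.comp (f := fun θ => (θ, a, e)) (by fun_prop)
  have hh (e : Action d) : Measurable fun θ => inner ℝ (hessian (η θ) a e) e :=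
    hη.measurable_inner_hessian.comp (f := fun θ => (θ, a, e, e)) (by fun_prop)
  refine ⟨?_, ?_, fun e he => ⟨?_, ?_⟩⟩
  · have := abs_integral_le_of_sq_le (c := 1) ((hη.measurable a').sub_const _) hL hBL
      (fun θ => by simpa using (hsq θ).1)
    simpa using this
  · have := abs_integral_le_of_sq_le (c := 1) ((hη.measurable a).sub_const _) hL hBL
      (fun θ => by simpa using (hsq θ).2.1)
    simpa using this
  · exact abs_integral_le_of_sq_le ((hg e).sub_const _) hL hBL
      (fun θ => ((hsq θ).2.2 e he).1)
  · exact abs_integral_le_of_sq_le ((hh e).sub_const _) hL hBL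
      (fun θ => ((hsq θ).2.2 e he).2)

/-- A maximizer of the expected virtual reward improves the real reward at every action that is not
an approximate local maximum, up to the prediction error. -/
theorem IsSmoothRewardClass.improvement (hη : IsSmoothRewardClass η ζg ζh ζ3) (hζh : 0 < ζh)
    (hζ3 : 0 < ζ3) {ε : ℝ} (hε : 0 < ε) (hε3 : 16 * ε ≤ ζ3) (θs : Θ) (p : Measure Θ)
    [IsProbabilityMeasure p] {a' a : Action d}
    (hmax : IsMaxOn (fun b => ∫ θ, η θ b ∂p) Set.univ a') {δ : ℝ}
    (hδ1 : δ ≤ ε ^ 2 / (4 * ζh)) (hδ2 : δ ≤ ε * √(ε / ζ3)) :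
    η θs a - (2 + ζg / ζh) * √(2 * expectedLoss η ζg ζh θs p a' a) ≤ η θs a' ∧
    (a ∉ approxLocalMaxima (η θs) ε (6 * √(ζ3 * ε)) →
      η θs a + δ - (2 + ζg / ζh) * √(2 * expectedLoss η ζg ζh θs p a' a) ≤ η θs a') := by
  obtain ⟨h1, h2, h3⟩ := hη.abs_mean_errors_le hζh θs p a' a rfl
  set B := expectedLoss η ζg ζh θs p a' a with hBdef
  have hB : 0 ≤ B := expectedLoss_nonneg θs p a' a
  have hζg : 0 ≤ ζg := (norm_nonneg _).trans (hη.norm_gradient_le θs a)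
  have hr : 0 ≤ ζg / ζh := div_nonneg hζg hζh.le
  set β := √B with hβ
  have hβ0 : 0 ≤ β := Real.sqrt_nonneg _
  have h2B : √(2 * B) = √2 * β := Real.sqrt_mul (by norm_num) _
  have h4B : √(4 * B) = 2 * β := by
    rw [Real.sqrt_mul (by norm_num), show (4 : ℝ) = 2 ^ 2 by norm_num, Real.sqrt_sq (by norm_num)]
  -- In the Hessian case the errors add up to `(2 + 1/16) √B`, which must fit below `2 √(2B)`.
  have hs2 : 1.4 ≤ √2 := Real.le_sqrt_of_sq_le (by norm_num)
  set S := √(2 * B) with hS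
  have hS0 : 0 ≤ S := Real.sqrt_nonneg _
  have hSβ : 1.4 * β ≤ S := by rw [h2B]; exact mul_le_mul_of_nonneg_right hs2 hβ0
  have hiη (b : Action d) : Integrable (fun θ => η θ b) p :=
    Integrable.of_bound (hη.measurable b).aestronglyMeasurable 1 (ae_of_all _ fun θ => by
      rw [Real.norm_of_nonneg (hη.mem_Icc θ b).1]; exact (hη.mem_Icc θ b).2)
  have hig (e : Action d) : Integrable (fun θ => inner ℝ (gradient (η θ) a) e) p :=
    Integrable.of_bound (hη.measurable_inner_gradient.comp
      (f := fun θ => (θ, a, e)) (by fun_prop)).aestronglyMeasurable (ζg * ‖e‖)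
      (ae_of_all _ fun θ => (norm_inner_le_norm _ _).trans
        (mul_le_mul_of_nonneg_right (hη.norm_gradient_le θ a) (norm_nonneg _)))
  have hih (e : Action d) : Integrable (fun θ => inner ℝ (hessian (η θ) a e) e) p :=
    Integrable.of_bound (hη.measurable_inner_hessian.comp
      (f := fun θ => (θ, a, e, e)) (by fun_prop)).aestronglyMeasurable (ζh * ‖e‖ * ‖e‖)
      (ae_of_all _ fun θ => (norm_inner_le_norm _ _).trans
        (mul_le_mul_of_nonneg_right (((hessian (η θ) a).le_opNorm e).trans
          (mul_le_mul_of_nonneg_right (hη.norm_hessian_le θ a) (norm_nonneg _))) (norm_nonneg _)))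
  rw [integral_sub (hiη _) (integrable_const _), integral_const, probReal_univ, one_smul] at h1 h2
  have hm (b : Action d) : ∫ θ, η θ b ∂p ≤ ∫ θ, η θ a' ∂p := hmax (Set.mem_univ b)
  have h1' := (abs_le.1 h1).2
  have h2' := (abs_le.1 h2).1
  have hrS : 0 ≤ ζg / ζh * S := mul_nonneg hr hS0
  refine ⟨by linarith [hm a], fun hnot => ?_⟩
  rw [approxLocalMaxima, Set.mem_ofPred_eq, not_and_or, not_le] at hnot
  rcases hnot with hG | hH
  · set g := gradient (η θs) a with hg
    have hG0 : 0 < ‖g‖ := hε.trans hG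
    set e := ‖g‖⁻¹ • g with he
    have he1 : ‖e‖ = 1 := by rw [he, norm_smul, norm_inv, norm_norm, inv_mul_cancel₀ hG0.ne']
    have hge : inner ℝ g e = ‖g‖ := by
      rw [he, real_inner_smul_right, real_inner_self_eq_norm_sq]
      field_simp
    have h3' := (h3 e he1).1
    rw [integral_sub (hig _) (integrable_const _), integral_const, probReal_univ, one_smul,
      hge] at h3'
    have h3'' := (abs_le.1 h3').1
    -- The length `‖g‖ / ζh` maximizes `s ‖g‖ - ζh s² / 2`. The gain `‖g‖² / (2 ζh)` is more than
    -- enough, and `‖g‖ ≤ ζg` turns the gradient error into the term `ζg / ζh` of the constant.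
    have hs0 : 0 ≤ ‖g‖ / ζh := by positivity
    have hT : ∫ θ, η θ a ∂p + ‖g‖ / ζh * ∫ θ, inner ℝ (gradient (η θ) a) e ∂p
        - ζh * (‖g‖ / ζh) ^ 2 / 2 ≤ ∫ θ, η θ (a + (‖g‖ / ζh) • e) ∂p := by
      have hadd : Integrable
          (fun θ => η θ a + ‖g‖ / ζh * inner ℝ (gradient (η θ) a) e) p :=
        (hiη a).add ((hig e).const_mul (‖g‖ / ζh))
      have := integral_mono (hadd.sub (integrable_const (ζh * (‖g‖ / ζh) ^ 2 / 2)))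
        (hiη (a + (‖g‖ / ζh) • e)) (fun θ => hη.quadratic_le θ a he1 hs0)
      simp only [Pi.sub_apply] at this
      rwa [integral_sub hadd (integrable_const _),
        integral_add (hiη a) ((hig e).const_mul (‖g‖ / ζh)), integral_const_mul, integral_const,
        probReal_univ, one_smul] at this
    have hA : ‖g‖ / ζh * (‖g‖ - S) ≤ ‖g‖ / ζh * ∫ θ, inner ℝ (gradient (η θ) a) e ∂p :=
      mul_le_mul_of_nonneg_left (by linarith) hs0
    have hC : ‖g‖ / ζh * S ≤ ζg / ζh * S :=
      mul_le_mul_of_nonneg_right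
        (div_le_div_of_nonneg_right (hη.norm_gradient_le θs a) hζh.le) hS0
    have hD : ε ^ 2 / (4 * ζh) ≤ ‖g‖ / ζh * ‖g‖ - ζh * (‖g‖ / ζh) ^ 2 / 2 := by
      have : ‖g‖ / ζh * ‖g‖ - ζh * (‖g‖ / ζh) ^ 2 / 2 = 2 * ‖g‖ ^ 2 / (4 * ζh) := by
        field_simp; ring
      rw [this]
      refine div_le_div_of_nonneg_right ?_ (by positivity)
      nlinarith
    have := hm (a + (‖g‖ / ζh) • e)
    linarith
  · push Not at hH
    obtain ⟨lam, heig, hlam⟩ := hH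
    obtain ⟨x, hx⟩ := heig.exists_hasEigenvector
    have hx0 : 0 < ‖x‖ := norm_pos_iff.2 hx.2
    have hHx : hessian (η θs) a x = lam • x := hx.apply_eq_smul
    -- An eigenvector may be reversed. The sign is fitted to the mean virtual slope, so the
    -- first-order term can be dropped without any gradient error.
    obtain ⟨e, he1, hHe, hsgn⟩ : ∃ e : Action d, ‖e‖ = 1 ∧ hessian (η θs) a e = lam • e ∧
        0 ≤ ∫ θ, inner ℝ (gradient (η θ) a) e ∂p := by
      have hn : ‖‖x‖⁻¹ • x‖ = 1 := by
        rw [norm_smul, norm_inv, norm_norm, inv_mul_cancel₀ hx0.ne']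
      have hh : hessian (η θs) a (‖x‖⁻¹ • x) = lam • (‖x‖⁻¹ • x) := by
        rw [map_smul, hHx, smul_comm]
      rcases le_total 0 (∫ θ, inner ℝ (gradient (η θ) a) (‖x‖⁻¹ • x) ∂p) with h | h
      · exact ⟨_, hn, hh, h⟩
      · refine ⟨-(‖x‖⁻¹ • x), by rw [norm_neg, hn], by rw [map_neg, hh, smul_neg], ?_⟩
        simp_rw [inner_neg_right]
        rw [integral_neg]
        linarith
    have hle : inner ℝ (hessian (η θs) a e) e = lam := by
      rw [hHe, real_inner_smul_left, real_inner_self_eq_norm_sq, he1]; ring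
    have h3' := (h3 e he1).2
    rw [integral_sub (hih _) (integrable_const _), integral_const, probReal_univ, one_smul,
      hle, h4B] at h3'
    have h3'' := (abs_le.1 h3').1
    -- Here `ζ3 s³ = ε s`: the curvature term is worth `3 ε s`, the Taylor remainder costs `ε s /
    -- 6`, and at least `δ ≤ ε s` is left. The curvature error is `s² √B` with `s² ≤ 1/16`.
    set s := √(ε / ζ3) with hs
    have hs0 : 0 ≤ s := Real.sqrt_nonneg _
    have hss : s ^ 2 = ε / ζ3 := Real.sq_sqrt (by positivity)
    have hsx : √(ζ3 * ε) = ζ3 * s := by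
      rw [show ζ3 * ε = ζ3 ^ 2 * (ε / ζ3) by field_simp, Real.sqrt_mul (by positivity),
        Real.sqrt_sq hζ3.le]
    have hT : ∫ θ, η θ a ∂p + s * ∫ θ, inner ℝ (gradient (η θ) a) e ∂p
        + s ^ 2 / 2 * ∫ θ, inner ℝ (hessian (η θ) a e) e ∂p - ζ3 * s ^ 3 / 6
        ≤ ∫ θ, η θ (a + s • e) ∂p := by
      have hadd : Integrable (fun θ => η θ a + s * inner ℝ (gradient (η θ) a) e) p :=
        (hiη a).add ((hig e).const_mul s)
      have hadd' : Integrable (fun θ => η θ a + s * inner ℝ (gradient (η θ) a) e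
          + s ^ 2 / 2 * inner ℝ (hessian (η θ) a e) e) p :=
        hadd.add ((hih e).const_mul (s ^ 2 / 2))
      have := integral_mono (hadd'.sub (integrable_const (ζ3 * s ^ 3 / 6)))
        (hiη (a + s • e)) (fun θ => hη.cubic_le θ a he1 hs0)
      simp only [Pi.sub_apply] at this
      rwa [integral_sub hadd' (integrable_const _),
        integral_add hadd ((hih e).const_mul (s ^ 2 / 2)),
        integral_add (hiη a) ((hig e).const_mul s), integral_const_mul, integral_const_mul,
        integral_const, probReal_univ, one_smul] at this
    have hA : 0 ≤ s * ∫ θ, inner ℝ (gradient (η θ) a) e ∂p := mul_nonneg hs0 hsgn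
    have hC : s ^ 2 / 2 * (6 * (ζ3 * s) - 2 * β)
        ≤ s ^ 2 / 2 * ∫ θ, inner ℝ (hessian (η θ) a e) e ∂p := by
      refine mul_le_mul_of_nonneg_left ?_ (by positivity)
      rw [hsx] at hlam
      linarith
    have hs16 : s ^ 2 ≤ 1 / 16 := by
      rw [hss, div_le_iff₀ hζ3]; linarith
    have hD : s ^ 2 * β ≤ 1 / 16 * β := mul_le_mul_of_nonneg_right hs16 hβ0
    have hE : ζ3 * s ^ 3 = ε * s := by
      rw [pow_succ, hss]; field_simp
    have hεs : 0 ≤ ε * s := mul_nonneg hε.le hs0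
    have hT' := hm (a + s • e)
    have hF : s ^ 2 / 2 * (6 * (ζ3 * s)) = 3 * (ε * s) := by rw [← hE]; ring
    rw [hE] at hT
    rw [mul_sub, hF] at hC
    linarith

end Improvement

/-! ### Telescoping the improvements -/

/-- Telescoping: if the reward increases by `δ ≤ 1` after every action outside `M`, up to errors,
then the regret with respect to `m`, a lower bound of the rewards on `M`, is bounded. -/
theorem sum_regret_le {α : Type*} {f : α → ℝ} (hf : ∀ a, f a ∈ Set.Icc (0 : ℝ) 1) {M : Set α}
    {m δ : ℝ} (hm1 : m ≤ 1) (hm : ∀ a ∈ M, m ≤ f a) (hδ0 : 0 ≤ δ) (hδ1 : δ ≤ 1) {T : ℕ}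
    (a : Fin (T + 1) → α) (r : Fin T → ℝ)
    (h0 : ∀ t, f (a t.castSucc) - r t ≤ f (a t.succ))
    (h : ∀ t, a t.castSucc ∉ M → f (a t.castSucc) + δ - r t ≤ f (a t.succ)) :
    δ * ∑ t : Fin T, (m - f (a t.succ)) ≤ 1 + ∑ t, r t := by
  -- On `M` the left side is nonpositive; off `M` it is at most `δ`, because `m ≤ 1` and `f ≥ 0`.
  have key : ∀ t : Fin T, δ * (m - f (a t.castSucc)) ≤ f (a t.succ) - f (a t.castSucc) + r t := by
    intro t
    by_cases hM : a t.castSucc ∈ M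
    · have := mul_nonneg hδ0 (sub_nonneg.2 (hm _ hM))
      linarith [h0 t]
    · have : δ * (m - f (a t.castSucc)) ≤ δ * 1 :=
        mul_le_mul_of_nonneg_left (by linarith [(hf (a t.castSucc)).1]) hδ0
      linarith [h t hM]
  have hsum := Finset.sum_le_sum fun t (_ : t ∈ Finset.univ) => key t
  rw [← Finset.mul_sum, Finset.sum_add_distrib] at hsum
  have e1 := Fin.sum_univ_succ fun i => m - f (a i)
  rw [Fin.sum_univ_castSucc] at e1
  have e2 : ∑ t : Fin T, (f (a t.succ) - f (a t.castSucc)) = f (a (Fin.last T)) - f (a 0) := by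
    have h1 := Fin.sum_univ_succ fun i => f (a i)
    rw [Fin.sum_univ_castSucc] at h1
    rw [Finset.sum_sub_distrib]
    linarith
  -- The improvements are charged to previous actions, the regret to current ones. The shift leaves
  -- `(1 - δ)(f(a_T) - f(a_0)) ≤ 1` in total, which uses `δ ≤ 1`.
  have e3 : ∑ t : Fin T, (m - f (a t.succ))
      = ∑ t : Fin T, (m - f (a t.castSucc)) + f (a 0) - f (a (Fin.last T)) := by linarith
  have hx := (hf (a 0)).1
  have hy := (hf (a (Fin.last T))).2
  rw [e3]
  nlinarith [mul_nonneg (sub_nonneg.2 hδ1) hx, mul_nonneg (sub_nonneg.2 hδ1) (sub_nonneg.2 hy)]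

/-! ### Runs of ViOlin and the learner's total loss -/

section Run

variable {Θ : Type*} [MeasurableSpace Θ] {d T : ℕ} {η : Θ → Action d → ℝ} {ζg ζh ζ3 : ℝ}
  {θs : Θ} {R : Learner (Datum d) Θ} {a₀ : Action d}
  {a : Fin (T + 1) → (Fin T → Action d × Action d) → Action d}

theorem IsViOlinRun.dependsOn_castSucc (ha : IsViOlinRun η θs R a₀ a) (t : Fin T) :
    DependsOn (a t.castSucc) (Set.Iio t) := by
  intro ξ ξ' h
  rcases Fin.eq_zero_or_eq_succ t.castSucc with h0 | ⟨s, hs⟩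
  · rw [h0, ha.init, ha.init]
  · rw [hs]
    refine ha.dependsOn s fun i hi => h i ?_
    have h1 : (t : ℕ) = s + 1 := by simpa using congrArg Fin.val hs
    have h2 : (i : ℕ) < s := hi
    have h3 : (i : ℕ) < t := by omega
    exact h3

theorem IsViOlinRun.measurable_datum (hη : IsSmoothRewardClass η ζg ζh ζ3)
    (ha : IsViOlinRun η θs R a₀ a) (t : Fin T) : Measurable fun ξ => datum (η θs) a ξ t := by
  have h : Measurable fun ξ => ((a t.succ ξ, a t.castSucc ξ), ξ t) :=
    ((ha.measurable _).prodMk (ha.measurable _)).prodMk (measurable_pi_apply t)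
  exact h.prodMk (hη.measurable_output.comp (measurable_const.prodMk h))

theorem IsViOlinRun.datum_congr (ha : IsViOlinRun η θs R a₀ a) {t : Fin T}
    {ξ ξ' : Fin T → Action d × Action d} (h : ∀ i ≤ t, ξ i = ξ' i) :
    datum (η θs) a ξ t = datum (η θs) a ξ' t := by
  have h' : ∀ i ∈ Set.Iio t, ξ i = ξ' i := fun i hi => h i (le_of_lt hi)
  simp only [datum]
  rw [ha.dependsOn t h', ha.dependsOn_castSucc t h', h t le_rfl]

/-- The environment of a run of ViOlin, as an adversary of the online learner. -/
def IsViOlinRun.adversary (hη : IsSmoothRewardClass η ζg ζh ζ3) (ha : IsViOlinRun η θs R a₀ a) :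
    Adversary (Action d × Action d) (Action d × Action d) (Fin 4 → ℝ) labels T where
  point t ξ := (a t.succ ξ, a t.castSucc ξ)
  label t ξ := (datum (η θs) a ξ t).2
  measurable_point t := (ha.measurable _).prodMk (ha.measurable _)
  measurable_label t := measurable_snd.comp (ha.measurable_datum hη t)
  point_dependsOn t ξ ξ' h := by
    simp only [ha.dependsOn t h, ha.dependsOn_castSucc t h]
  label_dependsOn t ξ ξ' h := by
    simp only [ha.datum_congr (fun i hi => h i hi)]
  label_mem t ξ := hη.output_mem_labels θs _

/-- The law of the parameter that the learner predicts in round `t` of a run. -/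
def prediction (η : Θ → Action d → ℝ) (θs : Θ) (R : Learner (Datum d) Θ)
    (a : Fin (T + 1) → (Fin T → Action d × Action d) → Action d) (t : Fin T)
    (ξ : Fin T → Action d × Action d) : Measure Θ :=
  R.predict t (past (datum (η θs) a ξ) t)

instance (t : Fin T) (ξ : Fin T → Action d × Action d) :
    IsProbabilityMeasure (prediction η θs R a t ξ) := by
  have := R.isMarkov t
  unfold prediction
  infer_instance

/-- The mean loss of the learner in round `t` of a run. -/
def roundLoss (η : Θ → Action d → ℝ) (ζg ζh : ℝ) (θs : Θ) (R : Learner (Datum d) Θ)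
    (a : Fin (T + 1) → (Fin T → Action d × Action d) → Action d) (t : Fin T)
    (ξ : Fin T → Action d × Action d) : ℝ :=
  ∫ θ, loss η ζg ζh (datum (η θs) a ξ t) θ ∂(prediction η θs R a t ξ)

instance (d T : ℕ) : IsProbabilityMeasure (noiseSeq d T) := by unfold noiseSeq; infer_instance

theorem IsViOlinRun.integrable_roundLoss (hη : IsSmoothRewardClass η ζg ζh ζ3)
    (ha : IsViOlinRun η θs R a₀ a) (t : Fin T) :
    Integrable (roundLoss η ζg ζh θs R a t) (noiseSeq d T) := by
  have := R.isMarkov t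
  have hpast : Measurable fun ξ => past (datum (η θs) a ξ) t :=
    measurable_pi_iff.2 fun j => ha.measurable_datum hη _
  have hm : StronglyMeasurable (roundLoss η ζg ζh θs R a t) := by
    have hf : StronglyMeasurable fun p : (Fin T → Action d × Action d) × Θ =>
        loss η ζg ζh (datum (η θs) a p.1 t) p.2 :=
      (hη.measurable_loss.comp
        (((ha.measurable_datum hη t).comp measurable_fst).prodMk
          measurable_snd)).stronglyMeasurable
    exact hf.integral_kernel_prod_right' (κ := (R.predict t).comap _ hpast)
  refine Integrable.of_bound hm.aestronglyMeasurable
    (2 + (2 * ζg) ^ 2 + (640 * √2 * ζh) ^ 2) (ae_of_all _ fun ξ => ?_)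
  have h := norm_integral_le_of_norm_le_const (μ := prediction η θs R a t ξ)
    (ae_of_all _ fun θ => hη.norm_loss_le (z := datum (η θs) a ξ t)
      (hη.output_mem_labels θs _) θ)
  simpa [roundLoss] using h

/-- The prediction and both actions of round `t` are determined before `ξ t`, so resampling `ξ t`
affects only the directions and the label computed from them. -/
theorem IsViOlinRun.integral_roundLoss_update (ha : IsViOlinRun η θs R a₀ a) (t : Fin T)
    (ξ : Fin T → Action d × Action d) :
    ∫ w, roundLoss η ζg ζh θs R a t (Function.update ξ t w) ∂(noise d)
      = expectedLoss η ζg ζh θs (prediction η θs R a t ξ) (a t.succ ξ) (a t.castSucc ξ) := by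
  have hu : ∀ w, ∀ i ∈ Set.Iio t, Function.update ξ t w i = ξ i := fun w i hi =>
    Function.update_of_ne (ne_of_lt hi) _ _
  have h1 : ∀ w, prediction η θs R a t (Function.update ξ t w) = prediction η θs R a t ξ := by
    intro w
    unfold prediction
    congr 1
    funext j
    exact ha.datum_congr fun i hi => hu w i (lt_of_le_of_lt hi (Fin.lt_def.2 j.2))
  have h2 : ∀ w, datum (η θs) a (Function.update ξ t w) t
      = (((a t.succ ξ, a t.castSucc ξ), w),
        output (η θs) ((a t.succ ξ, a t.castSucc ξ), w)) := by
    intro w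
    simp only [datum]
    rw [ha.dependsOn t (hu w), ha.dependsOn_castSucc t (hu w), Function.update_self]
  simp only [roundLoss, expectedLoss, h1, h2]

/-- The total loss of the learner in a run is its regret, because the ground truth has no loss. -/
theorem IsViOlinRun.sum_integral_roundLoss_le (hη : IsSmoothRewardClass η ζg ζh ζ3)
    (ha : IsViOlinRun η θs R a₀ a)
    (hR : R.AchievesRademacherRegret (loss η ζg ζh) labels (noise d) T) :
    ∑ t : Fin T, ∫ ξ, roundLoss η ζg ζh θs R a t ξ ∂(noiseSeq d T)
      ≤ 2 * rademacher η ζg ζh T := by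
  refine le_of_eq_of_le ?_ (hR (ha.adversary hη))
  have hinf : ∀ ξ, ⨅ θ : Θ, ∑ t : Fin T, loss η ζg ζh ((ha.adversary hη).data ξ t) θ = 0 := by
    intro ξ
    have h0 : ∀ θ, 0 ≤ ∑ t : Fin T, loss η ζg ζh ((ha.adversary hη).data ξ t) θ := fun θ =>
      Finset.sum_nonneg fun t _ => loss_nonneg _ _
    have hs : ∑ t : Fin T, loss η ζg ζh ((ha.adversary hη).data ξ t) θs = 0 :=
      Finset.sum_eq_zero fun t _ => loss_output_self θs _
    refine le_antisymm ?_ (Real.iInf_nonneg h0)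
    rw [← hs]
    exact ciInf_le ⟨0, by rintro _ ⟨θ, rfl⟩; exact h0 θ⟩ θs
  have hfun : (fun ξ => (∑ t : Fin T, ∫ θ, loss η ζg ζh ((ha.adversary hη).data ξ t) θ
        ∂(R.predict t (past ((ha.adversary hη).data ξ) t)))
      - ⨅ θ : Θ, ∑ t : Fin T, loss η ζg ζh ((ha.adversary hη).data ξ t) θ)
      = fun ξ => ∑ t : Fin T, roundLoss η ζg ζh θs R a t ξ := by
    funext ξ
    rw [hinf, sub_zero]
    rfl
  rw [regret, hfun, outerExpectation_eq_integral]
  · exact (integral_finsetSum _ fun t _ => ha.integrable_roundLoss hη t).symm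
  · exact integrable_finsetSum _ fun t _ => ha.integrable_roundLoss hη t

end Run

end NonlinearBandit

/-! ### Assembling the regret bound -/

/-- Jensen's inequality for the square root. -/
theorem integrable_sqrt_and_integral_sqrt_le {Ω : Type*} [MeasurableSpace Ω] {μ : Measure Ω}
    [IsProbabilityMeasure μ] {f : Ω → ℝ} (hf : Integrable f μ) (h0 : ∀ x, 0 ≤ f x) :
    Integrable (fun x => √(f x)) μ ∧ ∫ x, √(f x) ∂μ ≤ √(∫ x, f x ∂μ) := by
  have hm : AEStronglyMeasurable (fun x => √(f x)) μ :=
    Real.continuous_sqrt.comp_aestronglyMeasurable hf.1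
  have hsq : (fun x => √(f x) ^ 2) = f := funext fun x => Real.sq_sqrt (h0 x)
  have hi : Integrable (fun x => √(f x) ^ 2) μ := by rwa [hsq]
  refine ⟨((memLp_two_iff_integrable_sq hm).2 hi).integrable (by norm_num), ?_⟩
  exact (le_abs_self _).trans (abs_integral_le_of_integral_sq_le hm hi (by rw [hsq]))

theorem sum_sqrt_le_sqrt_card_mul {T : ℕ} (b : Fin T → ℝ) (hb : ∀ t, 0 ≤ b t) :
    ∑ t, √(b t) ≤ √(T * ∑ t, b t) := by
  refine Real.le_sqrt_of_sq_le ?_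
  have h := sq_sum_le_card_mul_sum_sq (s := Finset.univ) (f := fun t => √(b t))
  simpa [Real.sq_sqrt (hb _)] using h

theorem theorem3 {Θ : Type*} [MeasurableSpace Θ] {d T : ℕ}
    (η : Θ → NonlinearBandit.Action d → ℝ) (ζg ζh ζ3 : ℝ) (hζh : 0 < ζh)
    (hη : NonlinearBandit.IsSmoothRewardClass η ζg ζh ζ3) (θs : Θ)
    (R : OnlineLearning.Learner (NonlinearBandit.Datum d) Θ)
    (hR : R.AchievesRademacherRegret (NonlinearBandit.loss η ζg ζh) NonlinearBandit.labels
      (NonlinearBandit.noise d) T)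
    (ε : ℝ) (hε : 0 < ε) (hε' : ε ≤ min 1 (ζ3 / 16))
    (a₀ : NonlinearBandit.Action d)
    (a : Fin (T + 1) → (Fin T → NonlinearBandit.Action d × NonlinearBandit.Action d) →
      NonlinearBandit.Action d)
    (ha : NonlinearBandit.IsViOlinRun η θs R a₀ a) :
    ∫ ξ, NonlinearBandit.localRegret (η θs) ε (6 * √(ζ3 * ε)) (fun t : Fin T => a t.succ ξ)
        ∂(NonlinearBandit.noiseSeq d T) ≤
      (1 + (2 + ζg / ζh) * √(4 * T * NonlinearBandit.rademacher η ζg ζh T)) *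
        max (4 * ζh * ε ^ (-2 : ℝ)) (√ζ3 * ε ^ (-(3 / 2) : ℝ)) := by
  open NonlinearBandit in
  have hε1 : ε ≤ 1 := hε'.trans (min_le_left _ _)
  have hε3 : 16 * ε ≤ ζ3 := by linarith [hε'.trans (min_le_right _ _)]
  have hζ3 : 0 < ζ3 := by linarith
  have hζg : 0 ≤ ζg := (norm_nonneg _).trans (hη.norm_gradient_le θs a₀)
  have hC : 0 ≤ 2 + ζg / ζh := by positivity
  set C := 2 + ζg / ζh with hCdef
  set M := max (4 * ζh * ε ^ (-2 : ℝ)) (√ζ3 * ε ^ (-(3 / 2) : ℝ)) with hM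
  have hM1 : 4 * ζh * ε ^ (-2 : ℝ) ≤ M := le_max_left _ _
  have hM2 : √ζ3 * ε ^ (-(3 / 2) : ℝ) ≤ M := le_max_right _ _
  have hMpos : 0 < M := lt_of_lt_of_le (by positivity) hM1
  -- The guaranteed gain is `δ = M⁻¹`; the two terms of the maximum are the reciprocals of the
  -- gradient and Hessian gains.
  have hδ1 : M⁻¹ ≤ ε ^ 2 / (4 * ζh) := by
    have := inv_anti₀ (by positivity) hM1
    rwa [mul_inv, Real.rpow_neg hε.le, inv_inv, Real.rpow_two, ← div_eq_inv_mul] at this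
  have h32 : ε ^ (3 / 2 : ℝ) = ε * √ε := by
    rw [show (3 / 2 : ℝ) = 1 + 1 / 2 by norm_num, Real.rpow_add hε, Real.rpow_one,
      Real.sqrt_eq_rpow]
  have hδ2 : M⁻¹ ≤ ε * √(ε / ζ3) := by
    have := inv_anti₀ (by positivity) hM2
    rw [mul_inv, Real.rpow_neg hε.le, inv_inv, h32] at this
    rw [Real.sqrt_div hε.le]
    refine this.trans (le_of_eq ?_)
    ring
  have hδle : M⁻¹ ≤ 1 := by
    have h1 : √(ε / ζ3) ≤ 1 := by
      rw [Real.sqrt_le_one, div_le_one hζ3]; linarith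
    exact hδ2.trans (mul_le_one₀ hε1 (Real.sqrt_nonneg _) h1)
  have hf0 : ∀ b, 0 ≤ η θs b := fun b => (hη.mem_Icc θs b).1
  have hbdd : BddBelow (Set.range fun b : approxLocalMaxima (η θs) ε (6 * √(ζ3 * ε)) =>
      η θs b) := ⟨0, by rintro _ ⟨b, rfl⟩; exact hf0 _⟩
  set m := ⨅ b : approxLocalMaxima (η θs) ε (6 * √(ζ3 * ε)), η θs b with hm
  have hmle : ∀ b ∈ approxLocalMaxima (η θs) ε (6 * √(ζ3 * ε)), m ≤ η θs b := fun b hb =>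
    ciInf_le hbdd ⟨b, hb⟩
  have hm1 : m ≤ 1 := by
    rcases isEmpty_or_nonempty (approxLocalMaxima (η θs) ε (6 * √(ζ3 * ε))) with h | ⟨⟨b, hb⟩⟩
    -- Without approximate local maxima the real infimum is `0` by convention.
    · rw [hm, Real.iInf_of_isEmpty]; exact zero_le_one
    · exact (hmle b hb).trans (hη.mem_Icc θs b).2
  set B : Fin T → (Fin T → Action d × Action d) → ℝ := fun t ξ =>
    expectedLoss η ζg ζh θs (prediction η θs R a t ξ) (a t.succ ξ) (a t.castSucc ξ) with hB
  have hB0 : ∀ t ξ, 0 ≤ 2 * B t ξ := fun t ξ =>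
    mul_nonneg zero_le_two (expectedLoss_nonneg _ _ _ _)
  have hBint : ∀ t, Integrable (B t) (noiseSeq d T) ∧ ∫ ξ, B t ξ ∂(noiseSeq d T)
      = ∫ ξ, roundLoss η ζg ζh θs R a t ξ ∂(noiseSeq d T) := fun t => by
    have := integral_integral_update (noise d) t (ha.integrable_roundLoss hη t)
    simp only [ha.integral_roundLoss_update] at this
    exact this
  have hsqrt := fun t => integrable_sqrt_and_integral_sqrt_le ((hBint t).1.const_mul 2) (hB0 t)
  have hpt : ∀ ξ, M⁻¹ * localRegret (η θs) ε (6 * √(ζ3 * ε)) (fun t : Fin T => a t.succ ξ)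
      ≤ 1 + ∑ t, C * √(2 * B t ξ) := fun ξ =>
    sum_regret_le (hη.mem_Icc θs) hm1 hmle (inv_nonneg.2 hMpos.le) hδle (fun i => a i ξ) _
      (fun t => (hη.improvement hζh hζ3 hε hε3 θs (prediction η θs R a t ξ)
        (ha.isMaxOn t ξ) hδ1 hδ2).1)
      (fun t => (hη.improvement hζh hζ3 hε hε3 θs (prediction η θs R a t ξ)
        (ha.isMaxOn t ξ) hδ1 hδ2).2)
  have hreg : Integrable (fun ξ => localRegret (η θs) ε (6 * √(ζ3 * ε))
      (fun t : Fin T => a t.succ ξ)) (noiseSeq d T) := by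
    refine integrable_finsetSum _ fun t _ => (integrable_const m).sub ?_
    refine Integrable.of_bound
      ((hη.continuous θs).measurable.comp (ha.measurable t.succ)).aestronglyMeasurable 1
      (ae_of_all _ fun ξ => ?_)
    rw [Real.norm_of_nonneg (hf0 _)]
    exact (hη.mem_Icc θs _).2
  have hsumint : Integrable (fun ξ => ∑ t, C * √(2 * B t ξ)) (noiseSeq d T) :=
    integrable_finsetSum _ fun t _ => (hsqrt t).1.const_mul C
  have hmain := integral_mono (hreg.const_mul M⁻¹) ((integrable_const 1).add hsumint) hpt
  simp only [Pi.add_apply] at hmain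
  rw [integral_const_mul, integral_add (integrable_const 1) hsumint, integral_const,
    probReal_univ, one_smul, integral_finsetSum _ fun t _ => (hsqrt t).1.const_mul C] at hmain
  simp_rw [integral_const_mul] at hmain
  rw [← Finset.mul_sum] at hmain
  -- Jensen in each round and Cauchy–Schwarz over the rounds give `√(T ∑ E[2 Bₜ])`, and `∑ E[2 Bₜ] ≤
  -- 4 𝕽_T`.
  have hsum : ∑ t, ∫ ξ, √(2 * B t ξ) ∂(noiseSeq d T)
      ≤ √(4 * T * rademacher η ζg ζh T) := by
    refine (Finset.sum_le_sum fun t _ => (hsqrt t).2).trans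
      ((sum_sqrt_le_sqrt_card_mul _ fun t => integral_nonneg (hB0 t)).trans
        (Real.sqrt_le_sqrt ?_))
    simp_rw [integral_const_mul, (hBint _).2]
    rw [← Finset.mul_sum]
    have := mul_le_mul_of_nonneg_left (ha.sum_integral_roundLoss_le hη hR)
      (Nat.cast_nonneg (α := ℝ) T)
    linarith
  have hfin := hmain.trans (add_le_add_right (mul_le_mul_of_nonneg_left hsum hC) 1)
  rwa [inv_mul_le_iff₀ hMpos, mul_comm M] at hfin

end
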